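/- For positive integers $s_1,\dots,s_d$ with $s_1>1$ let $$\zeta(s_1,\dots,s_d)=\sum_{k_1>\cdots>k_d>0}k_1^{-s_1}\cdots k_d^{-s_d}$$ be the multiple zeta value of depth $d$, where the sum is over integers (for $d=1$ this is the usual $\zeta(s_1)$), and for positive integers $n,d$ let $$Q(4n,d)=\sum_{\substack{j_1+\cdots+j_d=n\\ j_1,\dots,j_d>0}}\zeta(4j_1,\dots,4j_d),$$ the sum over $d$-tuples of positive integers. For real $x$ write $\binom{x}{d}=x(x-1)\cdots(x-d+1)/d!$. Then for all integers $n\ge d\ge 3$, $$Q(4n,d)=\sum_{k=0}^{\lfloor\frac{d-1}{2}\rfloor}\sum_{j=0}^{2k+1}\frac{2^{k+2}(-1)^{\lfloor\frac{k}{2}\rfloor+j+d}}{(2k+1)!}\binom{2k+1}{j}\binom{\frac{j-2}{4}}{d}\,\zeta(4n-2k)\,\pi^{2k}$$ $$\qquad+\sum_{k=0}^{\lfloor\frac{d-2}{4}\rfloor}\sum_{j=0}^{4k+2}\frac{2^{2k+5}(-1)^{k+j+d}}{(4k+2)!}\binom{4k+2}{j}\binom{\frac{j-2}{4}}{d}\left(Q(4n-4k,2)-\frac{7}{8}\,\zeta(4n-4k)\right)\pi^{4k}.$$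 -/

import Mathlib

/-- The multiple zeta value `ζ(s₁, …, s_d) = ∑_{k₁ > ⋯ > k_d > 0} k₁^{-s₁} ⋯ k_d^{-s_d}`.
The case `d = 1` is the single zeta value `ζ(s₁)`. -/
noncomputable def multipleZeta {d : ℕ} (s : Fin d → ℕ) : ℝ :=
  ∑' k : {k : Fin d → ℕ // StrictAnti k ∧ ∀ i, 0 < k i}, ∏ i, ((k.1 i : ℝ) ^ s i)⁻¹

/-- The defining series of `multipleZeta s` converges when all arguments are at least `2`. -/
theorem multipleZeta_summable {d : ℕ} (s : Fin d → ℕ) (hs : ∀ i, 2 ≤ s i) :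
    Summable (fun k : {k : Fin d → ℕ // StrictAnti k ∧ ∀ i, 0 < k i} =>
      ∏ i, ((k.1 i : ℝ) ^ s i)⁻¹) := by
  have key : Summable (fun k : Fin d → ℕ => ∏ i, ((k i : ℝ) ^ s i)⁻¹) := by
    have h1 : ∀ i, Summable (fun m : ℕ => ((m : ℝ) ^ s i)⁻¹) := fun i =>
      Real.summable_nat_pow_inv.2 (hs i)
    refine summable_of_sum_le (c := ∏ i, ∑' m : ℕ, ((m : ℝ) ^ s i)⁻¹)
      (fun k => show (0 : ℝ) ≤ ∏ i, ((k i : ℝ) ^ s i)⁻¹ from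
        Finset.prod_nonneg fun i _ => by positivity) fun u => ?_
    calc ∑ k ∈ u, ∏ i, ((k i : ℝ) ^ s i)⁻¹
        ≤ ∑ k ∈ Fintype.piFinset (fun i => (u.image fun k => k i : Finset ℕ)),
            ∏ i, ((k i : ℝ) ^ s i)⁻¹ := by
          refine Finset.sum_le_sum_of_subset_of_nonneg (fun k hk => ?_)
            (fun k _ _ => show (0 : ℝ) ≤ ∏ i, ((k i : ℝ) ^ s i)⁻¹ from
              Finset.prod_nonneg fun i _ => by positivity)
          exact Fintype.mem_piFinset.2 fun i => Finset.mem_image_of_mem _ hk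
      _ = ∏ i, ∑ m ∈ (u.image fun k => k i : Finset ℕ), ((m : ℝ) ^ s i)⁻¹ :=
          (Finset.prod_univ_sum (fun i => u.image fun k => k i)
            (fun i (m : ℕ) => ((m : ℝ) ^ s i)⁻¹)).symm
      _ ≤ ∏ i, ∑' m : ℕ, ((m : ℝ) ^ s i)⁻¹ := by
          refine Finset.prod_le_prod (fun i _ => Finset.sum_nonneg fun m _ => by positivity)
            fun i _ => (h1 i).sum_le_tsum _ fun m _ => by positivity
  exact key.subtype {k : Fin d → ℕ | StrictAnti k ∧ ∀ i, 0 < k i}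

/-- The restricted sum `Q(4n, d)`: the sum of `ζ(4j₁, …, 4j_d)` over all `d`-tuples of positive
integers with `j₁ + ⋯ + j_d = n`. -/
noncomputable def restrictedSum (n d : ℕ) : ℝ :=
  ∑ j ∈ (Finset.finAntidiagonal d n).filter (fun j => ∀ i, 0 < j i),
    multipleZeta (fun i => 4 * j i)

/-!
With `t = x⁴`, the sums `Q(4n, d)` have the generating function
`∑ Q(4n, d) tⁿ y^d = ∏_k (1 + y t / (k⁴ - t)) = E((1 - y) t) / E(t)`, where
`E(t) = ∏_k (1 - t / k⁴) = sin (π x) sinh (π x) / (π x)²`.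
Taking the coefficient of `y^d` multiplies the coefficient of `tᵐ` in `E((1 - y) t)` by
`(-1)^d binom(m, d)`. In terms of `F = sin (π x) sinh (π x)`, which is `π² x² E(x⁴)`, this reads
`F · ∑ Q(4n, d) x^{4n} = D F`, where `D` multiplies the coefficient of `xⁿ` by
`(-1)^d binom((n - 2) / 4, d)` (`diag_sinSinhSeries`).

This multiplier is a polynomial of degree `d` in `n`. By Newton's interpolation formula, `D` is
therefore the differential operator `∑_{N ≤ d} Δ_N / N! · x^N (d/dx)^N`, where `Δ_N` is the `N`-th
difference of the multiplier at `0`; these differences are the inner sums over `j` in the theorem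
(`diag_signedChoose`). Because `F'''' = -4π⁴ F`, each quotient `x^N F^{(N)} / F` is, up to a factor
`(-4π⁴ x⁴)^k`, one of `1`, `H + C`, `2 H C` and `2π² x² (C - H)`, where `C = π x cot (π x)` and
`H = π x coth (π x)` (`X_pow_mul_iterate_derivative`). The coefficients of `C` and `H` are zeta
values, which gives the terms with odd `N`. Those of `H C` follow from the case `d = 2` of the same
formula and give the terms with `N ≡ 2 mod 4`. For `4 ∣ N` there is no contribution to the
coefficient of `x^{4n}`, since `n ≥ d`.

All computations take place in `ℂ⟦X⟧`. The generating function identity is proved for the sums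
truncated at `k ≤ K` (`prod_mul_elemSymm`), and `K` tends to infinity in each coefficient. That the
coefficients of `∏ (1 - x² / k²)` tend to those of `sin (π x) / (π x)` follows from Newton's
identities and Euler's formula for `ζ(2k)` (`tendsto_coeff_eulerProd_two`); the product with exponent
`4` is `∏ (1 - x² / k²) · ∏ (1 + x² / k²)`.
-/

namespace RestrictedZetaSum

open PowerSeries Filter Topology

/-! ### The generating function of truncated sums -/

/-- The power series `∑_{j ≥ 1} cʲ X^{rj} = c Xʳ / (1 - c Xʳ)`. -/
noncomputable def geomTail (r : ℕ) (c : ℂ) : ℂ⟦X⟧ :=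
  mk fun n => if r ∣ n ∧ 0 < n then c ^ (n / r) else 0

lemma one_sub_mul_geomTail {r : ℕ} (hr : 0 < r) (c : ℂ) :
    (1 - C c * X ^ r) * geomTail r c = C c * X ^ r := by
  ext n
  rw [sub_mul, one_mul, mul_assoc, map_sub, coeff_C_mul, coeff_C_mul, coeff_X_pow_mul', coeff_X_pow,
    geomTail, coeff_mk, coeff_mk]
  rcases lt_or_ge n r with h | h
  · have h1 : ¬ (r ∣ n ∧ 0 < n) := fun ⟨h1, h2⟩ => absurd (Nat.le_of_dvd h2 h1) (by omega)
    simp [h1, show ¬ r ≤ n by omega, h.ne]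
  · obtain ⟨m, rfl⟩ := Nat.exists_eq_add_of_le h
    rcases Nat.eq_zero_or_pos m with rfl | hm
    · simp [hr, Nat.div_self hr]
    · have : r + m ≠ r := by omega
      by_cases hd : r ∣ m
      · simp [hd, hm, Nat.add_div_left _ hr, pow_succ', hm.ne']
      · simp [hd, hm.ne']

/-- The elementary symmetric function of degree `d` in the values `g k`, `k ∈ s`. -/
noncomputable def elemSymm {R : Type*} [CommRing R] (s : Finset ℕ) (d : ℕ) (g : ℕ → R) : R :=
  ∑ A ∈ s.powersetCard d, ∏ k ∈ A, g k

lemma elemSymm_insert {R : Type*} [CommRing R] {s : Finset ℕ} {a : ℕ} (ha : a ∉ s) (d : ℕ)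
    (g : ℕ → R) :
    elemSymm (insert a s) (d + 1) g = elemSymm s (d + 1) g + g a * elemSymm s d g := by
  unfold elemSymm
  rw [Finset.powersetCard_succ_insert ha, Finset.sum_union, Finset.sum_image, Finset.mul_sum]
  · congr 1
    refine Finset.sum_congr rfl fun A hA => ?_
    rw [Finset.prod_insert fun h => ha ((Finset.mem_powersetCard.1 hA).1 h)]
  · intro A hA B hB h
    -- `insert a` is injective on the subsets that do not contain `a`.
    have hA' : a ∉ A := fun h => ha ((Finset.mem_powersetCard.1 hA).1 h)
    have hB' : a ∉ B := fun h => ha ((Finset.mem_powersetCard.1 hB).1 h)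
    rw [← Finset.erase_insert hA', ← Finset.erase_insert hB', h]
  · rw [Finset.disjoint_left]
    intro A hA hA'
    obtain ⟨B, -, rfl⟩ := Finset.mem_image.1 hA'
    exact ha ((Finset.mem_powersetCard.1 hA).1 (Finset.mem_insert_self _ _))

/-- The operator on power series that multiplies the coefficient of `Xⁿ` by `c n`. -/
noncomputable def diag (c : ℕ → ℂ) (F : ℂ⟦X⟧) : ℂ⟦X⟧ := mk fun n => c n * coeff n F

/-- The finite form of the generating function. Since `(1 - f Xʳ)(1 + y f Xʳ / (1 - f Xʳ)) =
1 - (1 - y) f Xʳ`, the product `P(Xʳ) = ∏ (1 - f k Xʳ)` satisfies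
`P(Xʳ) ∏ (1 + y · geomTail r (f k)) = P((1 - y) Xʳ)`; this is the coefficient of `y^d`. The real
binomial coefficient makes sense for all `n`, divisible by `r` or not, so that Pascal's rule gives
the induction on `s`. -/
lemma prod_mul_elemSymm {r : ℕ} (hr : 0 < r) (f : ℕ → ℂ) (s : Finset ℕ) (d : ℕ) :
    (∏ k ∈ s, (1 - C (f k) * X ^ r)) * elemSymm s d (fun k => geomTail r (f k)) =
      diag (fun n => (-1) ^ d * ((Ring.choose ((n : ℝ) / r) d : ℝ) : ℂ))
        (∏ k ∈ s, (1 - C (f k) * X ^ r)) := by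
  induction s using Finset.induction_on generalizing d with
  | empty =>
    ext n
    cases d with
    | zero => simp [elemSymm, diag]
    | succ d =>
      have h0 : elemSymm ∅ (d + 1) (fun k => geomTail r (f k)) = 0 := by
        rw [elemSymm, Finset.powersetCard_eq_empty.2 (by simp), Finset.sum_empty]
      rcases Nat.eq_zero_or_pos n with rfl | hn
      · simp [h0, diag, Ring.choose_zero_succ]
      · simp [h0, diag, coeff_one, hn.ne']
  | insert a s ha ih =>
    cases d with
    | zero => ext n; simp [elemSymm, diag]
    | succ d =>
      rw [Finset.prod_insert ha, elemSymm_insert ha]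
      set P := ∏ k ∈ s, (1 - C (f k) * X ^ r)
      -- The factor `1 - f a Xʳ` clears the denominator of `geomTail r (f a)`.
      have h1 : (1 - C (f a) * X ^ r) * P * (elemSymm s (d + 1) (fun k => geomTail r (f k))
            + geomTail r (f a) * elemSymm s d (fun k => geomTail r (f k)))
          = (1 - C (f a) * X ^ r) * (P * elemSymm s (d + 1) (fun k => geomTail r (f k)))
            + C (f a) * X ^ r * (P * elemSymm s d (fun k => geomTail r (f k))) := by
        linear_combination (P * elemSymm s d fun k => geomTail r (f k)) * one_sub_mul_geomTail hr (f a)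
      rw [h1, ih, ih]
      ext n
      simp only [sub_mul, one_mul, mul_assoc, map_add, map_sub, coeff_C_mul, coeff_X_pow_mul', diag,
        coeff_mk]
      split_ifs with h
      · obtain ⟨m, rfl⟩ := Nat.exists_eq_add_of_le h
        have h2 : ((r + m : ℕ) : ℝ) / r = (m : ℝ) / r + 1 := by
          push_cast; field_simp; ring
        rw [h2, Ring.choose_succ_succ, Nat.add_sub_cancel_left]
        push_cast
        ring
      · ring

/-! ### Convergence of the truncated sums -/

lemma coeff_prod_fin {d : ℕ} (g : Fin d → ℂ⟦X⟧) (N : ℕ) :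
    coeff N (∏ i, g i) = ∑ j ∈ Finset.finAntidiagonal d N, ∏ i, coeff (j i) (g i) := by
  classical
  rw [coeff_prod]
  refine Finset.sum_bij (fun l _ => ⇑l) ?_ ?_ ?_ ?_
  · intro l hl
    simpa using (Finset.mem_finsuppAntidiag.1 hl).1
  · intro a _ b _ h
    exact DFunLike.coe_injective h
  · intro j hj
    refine ⟨Finsupp.equivFunOnFinite.symm j, ?_, rfl⟩
    rw [Finset.mem_finsuppAntidiag]
    exact ⟨by simpa using hj, by simp⟩
  · intro _ _; rfl

/-- Strictly decreasing `d`-tuples in `s` correspond to `d`-element subsets of `s`, through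
the set of values of the tuple. -/
lemma sum_strictAnti_eq_elemSymm {R : Type*} [CommRing R] (s : Finset ℕ) (d : ℕ) (g : ℕ → R) :
    ∑ k ∈ (Fintype.piFinset fun _ : Fin d => s).filter (fun k => StrictAnti k), ∏ i, g (k i) =
      elemSymm s d g := by
  classical
  refine Finset.sum_nbij (fun k => Finset.univ.image k) ?_ ?_ ?_ ?_
  · intro k hk
    rw [Finset.mem_filter, Fintype.mem_piFinset] at hk
    rw [Finset.mem_powersetCard]
    refine ⟨?_, ?_⟩
    · intro x hx
      obtain ⟨i, -, rfl⟩ := Finset.mem_image.1 hx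
      exact hk.1 i
    · rw [Finset.card_image_of_injective _ hk.2.injective, Finset.card_fin]
  · intro k hk l hl h
    rw [Finset.mem_coe, Finset.mem_filter] at hk hl
    have hc : (Finset.univ.image k).card = d := by
      rw [Finset.card_image_of_injective _ hk.2.injective, Finset.card_fin]
    have h1 := Finset.orderEmbOfFin_unique hc (f := k ∘ Fin.rev)
      (fun i => Finset.mem_image_of_mem _ (Finset.mem_univ _))
      (fun i j hij => hk.2 (Fin.rev_lt_rev.2 hij))
    have h2 := Finset.orderEmbOfFin_unique hc (f := l ∘ Fin.rev)
      (fun i => by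
        have h' : Finset.univ.image k = Finset.univ.image l := h
        rw [h']
        exact Finset.mem_image_of_mem _ (Finset.mem_univ _))
      (fun i j hij => hl.2 (Fin.rev_lt_rev.2 hij))
    funext i
    simpa using congrFun (h1.trans h2.symm) i.rev
  · intro A hA
    obtain ⟨hA, hc⟩ := Finset.mem_powersetCard.1 (Finset.mem_coe.1 hA)
    refine ⟨fun i => A.orderEmbOfFin hc i.rev, ?_, ?_⟩
    · rw [Finset.mem_coe, Finset.mem_filter, Fintype.mem_piFinset]
      exact ⟨fun i => hA (Finset.orderEmbOfFin_mem _ _ _),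
        fun i j hij => (A.orderEmbOfFin hc).strictMono (Fin.rev_lt_rev.2 hij)⟩
    · have : (fun i => A.orderEmbOfFin hc i.rev) = A.orderEmbOfFin hc ∘ Fin.rev := rfl
      apply Finset.coe_injective
      simp [this, Set.range_comp, Fin.rev_surjective.range_eq]
  · intro k hk
    rw [Finset.prod_image fun i _ j _ h => (Finset.mem_filter.1 hk).2.injective h]

/-- A multiple zeta value is the limit of its sums truncated at `k₁ ≤ K`. -/
lemma tendsto_multipleZeta {d : ℕ} (s : Fin d → ℕ) (hs : ∀ i, 2 ≤ s i) :
    Tendsto (fun K : ℕ => ∑ k ∈ (Fintype.piFinset fun _ : Fin d => Finset.Icc 1 K).filter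
      (fun k => StrictAnti k), ∏ i, ((k i : ℝ) ^ s i)⁻¹) atTop (𝓝 (multipleZeta s)) := by
  classical
  have h := (multipleZeta_summable s hs).hasSum
  let B : ℕ → Finset {k : Fin d → ℕ // StrictAnti k ∧ ∀ i, 0 < k i} := fun K =>
    ((Fintype.piFinset fun _ : Fin d => Finset.Icc 1 K).filter (fun k => StrictAnti k)).subtype _
  have hB : Tendsto B atTop atTop := by
    refine tendsto_atTop_finset_of_monotone ?_ ?_
    · intro K L hKL k hk
      simp only [B, Finset.mem_subtype, Finset.mem_filter, Fintype.mem_piFinset,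
        Finset.mem_Icc] at hk ⊢
      exact ⟨fun i => ⟨(hk.1 i).1, (hk.1 i).2.trans hKL⟩, hk.2⟩
    · intro k
      refine ⟨∑ i, k.1 i, ?_⟩
      simp only [B, Finset.mem_subtype, Finset.mem_filter, Fintype.mem_piFinset, Finset.mem_Icc]
      exact ⟨fun i => ⟨k.2.2 i, Finset.single_le_sum (f := k.1) (fun _ _ => Nat.zero_le _)
        (Finset.mem_univ i)⟩, k.2.1⟩
  refine (h.comp hB).congr fun K => ?_
  simp only [B, Function.comp]
  refine Finset.sum_subtype_of_mem (fun k : Fin d → ℕ => ∏ i, ((k i : ℝ) ^ s i)⁻¹) ?_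
  intro k hk
  simp only [Finset.mem_filter, Fintype.mem_piFinset, Finset.mem_Icc] at hk
  exact ⟨hk.2, fun i => (hk.1 i).1⟩

/-- The generating series of the depth `d` multiple zeta values with arguments divisible by `r`:
the coefficient of `X^N` is the sum of `ζ(j₁, …, j_d)` over the positive multiples `j₁, …, j_d` of
`r` with `j₁ + ⋯ + j_d = N`. -/
noncomputable def zetaSeries (r d : ℕ) : ℂ⟦X⟧ :=
  mk fun N => ((∑ j ∈ (Finset.finAntidiagonal d N).filter (fun j => ∀ i, r ∣ j i ∧ 0 < j i),
    multipleZeta j : ℝ) : ℂ)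

lemma coeff_geomTail_inv {r : ℕ} (k n : ℕ) :
    coeff n (geomTail r ((k : ℂ) ^ r)⁻¹) =
      if r ∣ n ∧ 0 < n then ((((k : ℝ) ^ n)⁻¹ : ℝ) : ℂ) else 0 := by
  rw [geomTail, coeff_mk]
  split_ifs with h
  · rw [inv_pow, ← pow_mul, Nat.mul_div_cancel' h.1]; push_cast; rfl
  · rfl

lemma tendsto_coeff_elemSymm {r : ℕ} (hr : 2 ≤ r) (d N : ℕ) :
    Tendsto (fun K : ℕ => coeff N (elemSymm (Finset.Icc 1 K) d
      (fun k => geomTail r ((k : ℂ) ^ r)⁻¹))) atTop (𝓝 (coeff N (zetaSeries r d))) := by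
  classical
  have h1 : ∀ K : ℕ, coeff N (elemSymm (Finset.Icc 1 K) d
      (fun k => geomTail r ((k : ℂ) ^ r)⁻¹)) =
      ((∑ j ∈ (Finset.finAntidiagonal d N).filter (fun j => ∀ i, r ∣ j i ∧ 0 < j i),
        ∑ k ∈ (Fintype.piFinset fun _ : Fin d => Finset.Icc 1 K).filter
          (fun k => StrictAnti k), ∏ i, ((k i : ℝ) ^ j i)⁻¹ : ℝ) : ℂ) := by
    intro K
    rw [← sum_strictAnti_eq_elemSymm, map_sum, Finset.sum_comm]
    push_cast
    refine Finset.sum_congr rfl fun k _ => ?_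
    rw [coeff_prod_fin, Finset.sum_filter]
    refine Finset.sum_congr rfl fun j _ => ?_
    simp only [coeff_geomTail_inv]
    split_ifs with h
    · refine Finset.prod_congr rfl fun i _ => ?_
      rw [if_pos (h i)]; push_cast; rfl
    · push Not at h
      obtain ⟨i, hi⟩ := h
      exact Finset.prod_eq_zero (Finset.mem_univ i) (if_neg fun h => (hi h.1).not_gt h.2)
  simp only [h1, zetaSeries, coeff_mk]
  refine (Complex.continuous_ofReal.tendsto _).comp (tendsto_finsetSum _ fun j hj => ?_)
  refine tendsto_multipleZeta j fun i => hr.trans ?_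
  have := (Finset.mem_filter.1 hj).2 i
  exact Nat.le_of_dvd this.2 this.1

lemma zetaSeries_one_coeff (r N : ℕ) :
    coeff N (zetaSeries r 1) = if r ∣ N ∧ 0 < N then (multipleZeta ![N] : ℂ) else 0 := by
  have h : Finset.finAntidiagonal 1 N = {![N]} := by
    ext j
    rw [Finset.mem_finAntidiagonal, Finset.mem_singleton]
    constructor
    · intro h
      ext i
      simpa [Subsingleton.elim i 0] using h
    · rintro rfl; simp
  rw [zetaSeries, coeff_mk, h, Finset.filter_singleton]
  split_ifs with h1 h2 h2
  · simp
  · exact absurd (by simpa using h1) h2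
  · exact absurd (by simpa using h2) h1
  · simp

/-- Euler's formula for `ζ(2k)`. -/
lemma multipleZeta_single_even {k : ℕ} (hk : k ≠ 0) :
    multipleZeta ![2 * k] = (-1 : ℝ) ^ (k + 1) * (2 : ℝ) ^ (2 * k - 1) * Real.pi ^ (2 * k) *
        bernoulli (2 * k) / (2 * k).factorial := by
  have h1 := tendsto_multipleZeta ![2 * k] (fun i => by simp; omega)
  have h2 := ((hasSum_zeta_nat hk).tendsto_sum_nat).comp (tendsto_add_atTop_nat 1)
  refine tendsto_nhds_unique h1 (h2.congr fun K => ?_)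
  have h3 := sum_strictAnti_eq_elemSymm (Finset.Icc 1 K) 1 (fun n => ((n : ℝ) ^ (2 * k))⁻¹)
  simp only [Fin.prod_univ_one, Matrix.cons_val_fin_one] at h3 ⊢
  rw [h3, elemSymm, Finset.powersetCard_one, Finset.sum_map, Function.comp]
  rw [Finset.sum_range_succ', Finset.range_eq_Ico,
    Finset.sum_Ico_add' (fun n : ℕ => 1 / (n : ℝ) ^ (2 * k)) 0 K 1]
  simp [hk]
  rfl

/-! ### Exponential, hyperbolic and cotangent series -/

/-- The power series of `exp (a x)`. -/
noncomputable def expSeries (a : ℂ) : ℂ⟦X⟧ := rescale a (exp ℂ)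

lemma coeff_expSeries (a : ℂ) (n : ℕ) : coeff n (expSeries a) = a ^ n / n.factorial := by
  simp [expSeries, coeff_rescale, coeff_exp, div_eq_mul_inv]

lemma expSeries_mul (a b : ℂ) : expSeries a * expSeries b = expSeries (a + b) :=
  exp_mul_exp_eq_exp_add a b

lemma rescale_expSeries (a b : ℂ) : rescale b (expSeries a) = expSeries (a * b) := by
  rw [expSeries, expSeries, rescale_rescale]

lemma derivative_expSeries (a : ℂ) : d⁄dX ℂ (expSeries a) = C a * expSeries a := by
  ext n
  rw [coeff_derivative, coeff_C_mul, coeff_expSeries, coeff_expSeries, Nat.factorial_succ]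
  push_cast
  have : (n.factorial : ℂ) ≠ 0 := by exact_mod_cast n.factorial_ne_zero
  have : (n + 1 : ℂ) ≠ 0 := by exact_mod_cast n.succ_ne_zero
  field_simp
  ring

/-- The power series of `2 sinh (a x)`; for `a = π i` it is `2i sin (π x)`. -/
noncomputable def sinhSeries (a : ℂ) : ℂ⟦X⟧ := expSeries a - expSeries (-a)

/-- The power series of `2 cosh (a x)`; for `a = π i` it is `2 cos (π x)`. -/
noncomputable def coshSeries (a : ℂ) : ℂ⟦X⟧ := expSeries a + expSeries (-a)

lemma derivative_sinhSeries (a : ℂ) : d⁄dX ℂ (sinhSeries a) = C a * coshSeries a := by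
  simp only [sinhSeries, coshSeries, map_sub, derivative_expSeries, map_neg]; ring

lemma derivative_coshSeries (a : ℂ) : d⁄dX ℂ (coshSeries a) = C a * sinhSeries a := by
  simp only [sinhSeries, coshSeries, map_add, derivative_expSeries, map_neg]; ring

lemma rescale_sinhSeries (a b : ℂ) : rescale b (sinhSeries a) = sinhSeries (a * b) := by
  simp [sinhSeries, rescale_expSeries]

lemma rescale_coshSeries (a b : ℂ) : rescale b (coshSeries a) = coshSeries (a * b) := by
  simp [coshSeries, rescale_expSeries]

/-- The power series of `π x coth (π x) = 2π x / (exp (2π x) - 1) + π x`, written with the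
exponential generating function of the Bernoulli numbers. -/
noncomputable def cothSeries : ℂ⟦X⟧ :=
  rescale (2 * Real.pi : ℂ) (bernoulliPowerSeries ℂ) + C (Real.pi : ℂ) * X

/-- The power series of `π x cot (π x)`, obtained from `π x coth (π x)` by `x ↦ i x`. -/
noncomputable def cotSeries : ℂ⟦X⟧ := rescale Complex.I cothSeries

lemma cothSeries_mul_sinhSeries :
    cothSeries * sinhSeries Real.pi = C (Real.pi : ℂ) * X * coshSeries Real.pi := by
  have h := congrArg (rescale (2 * Real.pi : ℂ)) (bernoulliPowerSeries_mul_exp_sub_one ℂ)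
  rw [map_mul, map_sub, map_one, rescale_X, ← expSeries] at h
  -- `2 sinh (π x) = (exp (2π x) - 1) exp (-π x)`
  have h1 : sinhSeries Real.pi = (expSeries (2 * Real.pi) - 1) * expSeries (-Real.pi : ℂ) := by
    rw [sub_mul, expSeries_mul, one_mul, sinhSeries]; ring_nf
  have h2 : C (2 * Real.pi : ℂ) = 2 * C (Real.pi : ℂ) := by rw [map_mul]; rfl
  rw [h2] at h
  calc cothSeries * sinhSeries Real.pi
      = rescale (2 * Real.pi : ℂ) (bernoulliPowerSeries ℂ) * (expSeries (2 * Real.pi) - 1)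
          * expSeries (-Real.pi : ℂ) + C (Real.pi : ℂ) * X * sinhSeries Real.pi := by
        rw [cothSeries, add_mul, h1]; ring
    _ = _ := by rw [h, sinhSeries, coshSeries]; ring

lemma cotSeries_mul_sinhSeries :
    cotSeries * sinhSeries (Real.pi * Complex.I) =
      C (Real.pi * Complex.I : ℂ) * X * coshSeries (Real.pi * Complex.I) := by
  have h := congrArg (rescale Complex.I) cothSeries_mul_sinhSeries
  rw [map_mul, map_mul, map_mul, rescale_X, rescale_sinhSeries, rescale_coshSeries] at h
  rw [cotSeries, h, map_mul]
  have : rescale Complex.I (C (Real.pi : ℂ)) = C (Real.pi : ℂ) := by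
    ext n; rw [coeff_rescale, coeff_C]; split_ifs with h <;> simp [h]
  rw [this]; ring

lemma coeff_cothSeries (n : ℕ) : coeff n cothSeries =
    if n = 0 then 1 else if Even n then -2 * (-1) ^ (n / 2) * (multipleZeta ![n] : ℂ) else 0 := by
  rw [cothSeries, map_add, coeff_rescale, coeff_C_mul, coeff_X, bernoulliPowerSeries, coeff_mk]
  rcases eq_or_ne n 0 with rfl | h0
  · simp
  rcases eq_or_ne n 1 with rfl | h1
  · norm_num [bernoulli_one]; ring
  rw [if_neg h0, if_neg h1]
  split_ifs with h2
  · obtain ⟨k, rfl⟩ := h2.two_dvd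
    have hk : k ≠ 0 := by omega
    rw [multipleZeta_single_even hk, Nat.mul_div_cancel_left _ two_pos]
    have : (2 : ℂ) ^ (2 * k) = 2 * 2 ^ (2 * k - 1) := by
      rw [← pow_succ']; congr 1; omega
    push_cast
    rw [mul_pow, this]
    have h : ((-1 : ℂ) ^ k) * (-1) ^ k = 1 := by rw [← mul_pow]; simp
    simp only [eq_ratCast, pow_succ]
    linear_combination (-(2 * 2 ^ (2 * k - 1) * (Real.pi : ℂ) ^ (2 * k) * bernoulli (2 * k) /
      (2 * k).factorial)) * h
  · have : bernoulli n = 0 := bernoulli_eq_zero_of_odd (Nat.not_even_iff_odd.1 h2) (by omega)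
    simp [this]

lemma coeff_cotSeries (n : ℕ) : coeff n cotSeries =
    if n = 0 then 1 else if Even n then -2 * (multipleZeta ![n] : ℂ) else 0 := by
  rw [cotSeries, coeff_rescale, coeff_cothSeries]
  split_ifs with h1 h2
  · simp [h1]
  · obtain ⟨k, rfl⟩ := h2.two_dvd
    rw [pow_mul, Complex.I_sq, Nat.mul_div_cancel_left _ two_pos]
    have h : ((-1 : ℂ) ^ k) * (-1) ^ k = 1 := by rw [← mul_pow]; simp
    linear_combination (-2 * (multipleZeta ![2 * k] : ℂ)) * h
  · simp

/-- The expansion `π x cot (π x) = 1 - 2 ∑_{k ≥ 1} ζ(2k) x^{2k}`. -/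
lemma cotSeries_eq : cotSeries = 1 - 2 * zetaSeries 2 1 := by
  ext n
  rw [coeff_cotSeries, map_sub, coeff_one, two_mul, map_add, zetaSeries_one_coeff]
  simp only [even_iff_two_dvd]
  rcases Nat.eq_zero_or_pos n with rfl | hn
  · simp
  · by_cases h : 2 ∣ n <;> simp [h, hn, hn.ne']; ring

/-! ### Euler products -/

/-- The power series of `sin (π x) / (π x)`, the coefficients of `sinhSeries (π i)` shifted by one
and divided by the leading one, `2π i`. -/
noncomputable def sincSeries : ℂ⟦X⟧ :=
  mk fun n => coeff (n + 1) (sinhSeries (Real.pi * Complex.I)) / (2 * (Real.pi * Complex.I))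

lemma piI_ne : (Real.pi * Complex.I : ℂ) ≠ 0 := by simp [Real.pi_ne_zero]

lemma X_mul_sincSeries : C (2 * (Real.pi * Complex.I)) * (X * sincSeries) =
    sinhSeries (Real.pi * Complex.I) := by
  ext n
  rw [coeff_C_mul]
  cases n with
  | zero => rw [coeff_zero_X_mul, sinhSeries, map_sub, coeff_expSeries, coeff_expSeries]; simp
  | succ n =>
    rw [coeff_succ_X_mul, sincSeries, coeff_mk]
    have := piI_ne
    field_simp

lemma coeff_zero_sincSeries : coeff 0 sincSeries = 1 := by
  rw [sincSeries, coeff_mk, sinhSeries, map_sub, coeff_expSeries, coeff_expSeries]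
  have := piI_ne
  simp
  field_simp
  norm_num

/-- The logarithmic derivative `x S' / S = π x cot (π x) - 1` of `S = sin (π x) / (π x)`, in the
shape of `prod_mul_elemSymm` for `r = 2` and `d = 1`. -/
lemma sincSeries_mul : sincSeries * zetaSeries 2 1 = diag (fun n => -((n : ℂ) / 2)) sincSeries := by
  have hc : C (2 * (Real.pi * Complex.I)) ≠ 0 := by
    intro h; simp [Real.pi_ne_zero] at h
  have h1 : X * (cotSeries * sincSeries) = X * (sincSeries + X * d⁄dX ℂ sincSeries) := by
    apply mul_left_cancel₀ hc
    have h2 := cotSeries_mul_sinhSeries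
    have h3 := congrArg (d⁄dX ℂ) X_mul_sincSeries
    rw [derivative_sinhSeries] at h3
    simp only [Derivation.leibniz, smul_eq_mul, derivative_C, derivative_X] at h3
    rw [← X_mul_sincSeries] at h2
    linear_combination h2 - X * h3
  have h4 := mul_left_cancel₀ X_ne_zero h1
  rw [cotSeries_eq] at h4
  ext n
  have h5 := congrArg (coeff n) h4
  have h6 : coeff n (X * d⁄dX ℂ sincSeries) = n * coeff n sincSeries := by
    cases n with
    | zero => simp
    | succ n => rw [coeff_succ_X_mul, coeff_derivative]; push_cast; ring
  rw [map_add, h6, sub_mul, one_mul, map_sub, mul_assoc, two_mul, map_add] at h5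
  rw [diag, coeff_mk, mul_comm sincSeries]
  linear_combination (-1/2) * h5

/-- Newton's identities `P Z = -(x/2) P'` determine the coefficients of `P` recursively from those
of `Z`, hence coefficientwise convergence passes from `Z` to `P`. -/
lemma tendsto_coeff_of_mul_eq_diag {P Z : ℕ → ℂ⟦X⟧} {Y W : ℂ⟦X⟧}
    (hP0 : ∀ K, coeff 0 (P K) = 1) (hY0 : coeff 0 Y = 1)
    (hZ0 : ∀ K, coeff 0 (Z K) = 0) (hW0 : coeff 0 W = 0)
    (hP : ∀ K, P K * Z K = diag (fun n => -((n : ℂ) / 2)) (P K))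
    (hY : Y * W = diag (fun n => -((n : ℂ) / 2)) Y)
    (hZ : ∀ n, Tendsto (fun K => coeff n (Z K)) atTop (𝓝 (coeff n W))) (n : ℕ) :
    Tendsto (fun K => coeff n (P K)) atTop (𝓝 (coeff n Y)) := by
  induction n using Nat.strong_induction_on with
  | _ n ih =>
    rcases Nat.eq_zero_or_pos n with rfl | hn
    · simp only [hP0, hY0]; exact tendsto_const_nhds
    have key : ∀ A B : ℂ⟦X⟧, A * B = diag (fun n => -((n : ℂ) / 2)) A →
        coeff n A = -(2 / n) * ∑ p ∈ Finset.HasAntidiagonal.antidiagonal n, coeff p.1 A * coeff p.2 B := by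
      intro A B h
      have hn' : (n : ℂ) ≠ 0 := by exact_mod_cast hn.ne'
      rw [← coeff_mul, h, diag, coeff_mk]
      field_simp
    simp only [fun K => key _ _ (hP K), key _ _ hY]
    refine (tendsto_finsetSum _ fun p hp => ?_).const_mul _
    rcases Nat.eq_zero_or_pos p.2 with h0 | h0
    -- The term with `p.1 = n` has the factor `coeff 0 Z = 0`, so only smaller indices occur.
    · simp only [h0, hZ0, hW0, mul_zero]; exact tendsto_const_nhds
    · exact (ih p.1 (by have := Finset.HasAntidiagonal.mem_antidiagonal.1 hp; omega)).mul (hZ _)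

/-- The polynomial `∏_{k ≤ K} (1 - xʳ / kʳ)`, as a power series. -/
noncomputable def eulerProd (r K : ℕ) : ℂ⟦X⟧ :=
  ∏ k ∈ Finset.Icc 1 K, (1 - C ((k : ℂ) ^ r)⁻¹ * X ^ r)

/-- Euler's product for the sine, coefficient by coefficient. -/
lemma tendsto_coeff_eulerProd_two (n : ℕ) :
    Tendsto (fun K => coeff n (eulerProd 2 K)) atTop (𝓝 (coeff n sincSeries)) := by
  refine tendsto_coeff_of_mul_eq_diag (W := zetaSeries 2 1)
    (Z := fun K => elemSymm (Finset.Icc 1 K) 1 (fun k => geomTail 2 ((k : ℂ) ^ 2)⁻¹)) ?_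
    coeff_zero_sincSeries ?_ ?_ ?_ sincSeries_mul (tendsto_coeff_elemSymm le_rfl 1) n
  · intro K; simp [eulerProd, map_prod]
  · intro K
    simp [elemSymm, Finset.powersetCard_one, geomTail]
  · simp [zetaSeries_one_coeff]
  · intro K
    have := prod_mul_elemSymm two_pos (fun k => ((k : ℂ) ^ 2)⁻¹) (Finset.Icc 1 K) 1
    simp only [Ring.choose_one_right] at this
    rw [← eulerProd] at this
    rw [this]
    ext m
    simp [diag]

lemma eulerProd_four (K : ℕ) :
    eulerProd 4 K = eulerProd 2 K * rescale Complex.I (eulerProd 2 K) := by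
  unfold eulerProd
  rw [map_prod, ← Finset.prod_mul_distrib]
  refine Finset.prod_congr rfl fun k _ => ?_
  have h : rescale Complex.I (C ((k : ℂ) ^ 2)⁻¹) = C ((k : ℂ) ^ 2)⁻¹ := by
    ext n; rw [coeff_rescale, coeff_C]; split_ifs with h <;> simp [h]
  rw [map_sub, map_mul, map_one, map_pow, rescale_X, h, mul_pow, ← map_pow C Complex.I,
    Complex.I_sq, show ((k : ℂ) ^ 4)⁻¹ = ((k : ℂ) ^ 2)⁻¹ * ((k : ℂ) ^ 2)⁻¹ by
      rw [← mul_inv]; ring_nf, map_mul C, map_neg, map_one]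
  ring

lemma tendsto_coeff_mul {A B : ℕ → ℂ⟦X⟧} {a b : ℂ⟦X⟧}
    (hA : ∀ n, Tendsto (fun K => coeff n (A K)) atTop (𝓝 (coeff n a)))
    (hB : ∀ n, Tendsto (fun K => coeff n (B K)) atTop (𝓝 (coeff n b))) (n : ℕ) :
    Tendsto (fun K => coeff n (A K * B K)) atTop (𝓝 (coeff n (a * b))) := by
  simp only [coeff_mul]
  exact tendsto_finsetSum _ fun p _ => (hA _).mul (hB _)

/-- The coefficients of `∏ (1 - x⁴ / k⁴)` are those of
`sin (π x) sinh (π x) / (π x)²`. -/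
lemma tendsto_coeff_eulerProd_four (n : ℕ) :
    Tendsto (fun K => coeff n (eulerProd 4 K)) atTop
      (𝓝 (coeff n (sincSeries * rescale Complex.I sincSeries))) := by
  simp only [eulerProd_four]
  refine tendsto_coeff_mul tendsto_coeff_eulerProd_two (fun m => ?_) n
  simp only [coeff_rescale]
  exact (tendsto_coeff_eulerProd_two m).const_mul _

/-- The limit of `prod_mul_elemSymm` for `r = 4` and `f k = k⁻⁴`. -/
lemma sinc_mul_sinc_mul_zetaSeries (d : ℕ) :
    sincSeries * rescale Complex.I sincSeries * zetaSeries 4 d =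
      diag (fun n => (-1) ^ d * ((Ring.choose ((n : ℝ) / 4) d : ℝ) : ℂ))
        (sincSeries * rescale Complex.I sincSeries) := by
  ext n
  refine tendsto_nhds_unique (tendsto_coeff_mul tendsto_coeff_eulerProd_four
    (tendsto_coeff_elemSymm (by norm_num) d) n) ?_
  rw [diag, coeff_mk]
  refine ((tendsto_coeff_eulerProd_four n).const_mul _).congr fun K => ?_
  rw [eulerProd, prod_mul_elemSymm (by norm_num), diag, coeff_mk, Nat.cast_ofNat]

/-! ### The product of sine and hyperbolic sine -/

/-- The power series of `4i sin (π x) sinh (π x)`, a constant multiple of `x² ∏ (1 - x⁴ / k⁴)`. -/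
noncomputable def sinSinhSeries : ℂ⟦X⟧ := sinhSeries Real.pi * sinhSeries (Real.pi * Complex.I)

/-- The polynomial `(-1)^d binom((x - 2) / 4, d)` in `x`. The shift by `2` comes from the factor
`x²` in `sinSinhSeries`. -/
noncomputable def signedChoose (d : ℕ) (x : ℝ) : ℝ := (-1) ^ d * Ring.choose ((x - 2) / 4) d

lemma rescale_C (a c : ℂ) : rescale a (C c) = C c := by
  ext n; rw [coeff_rescale, coeff_C]; split_ifs with h <;> simp [h]

lemma exists_sinSinhSeries_eq : ∃ c : ℂ, sinSinhSeries =
    C c * (X ^ 2 * (sincSeries * rescale Complex.I sincSeries)) := by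
  have h := congrArg (rescale Complex.I) X_mul_sincSeries
  rw [map_mul (rescale _), map_mul (rescale _), rescale_X, rescale_sinhSeries, rescale_C,
    mul_assoc (Real.pi : ℂ), Complex.I_mul_I,
    mul_neg_one] at h
  have h1 : sinhSeries (-Real.pi) = -sinhSeries Real.pi := by simp [sinhSeries]
  rw [h1] at h
  refine ⟨-(2 * (Real.pi * Complex.I)) ^ 2 * Complex.I, ?_⟩
  rw [sinSinhSeries, ← X_mul_sincSeries, ← neg_eq_iff_eq_neg.2 h]
  simp only [map_mul, map_neg, map_pow]
  ring

lemma diag_sinSinhSeries (d : ℕ) :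
    diag (fun n => (signedChoose d n : ℂ)) sinSinhSeries = sinSinhSeries * zetaSeries 4 d := by
  obtain ⟨c, hc⟩ := exists_sinSinhSeries_eq
  rw [hc, mul_assoc, mul_assoc (X ^ 2), sinc_mul_sinc_mul_zetaSeries]
  ext n
  rw [diag, coeff_mk, coeff_C_mul, coeff_C_mul, coeff_X_pow_mul', coeff_X_pow_mul']
  split_ifs with h
  · rw [diag, coeff_mk, signedChoose, Nat.cast_sub h]
    push_cast
    ring
  · simp

/-! ### Newton interpolation -/

/-- The `N`-th forward difference of `signedChoose d` at `0`. -/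
noncomputable def newtonCoeff (d N : ℕ) : ℝ :=
  ∑ j ∈ Finset.range (N + 1), (-1) ^ (N + j) * (N.choose j : ℝ) * signedChoose d j

lemma fwdDiff_iter_signedChoose (d N : ℕ) :
    (fwdDiff (1 : ℝ))^[N] (signedChoose d) 0 = newtonCoeff d N := by
  rw [fwdDiff_iter_eq_sum_shift, newtonCoeff]
  refine Finset.sum_congr rfl fun j hj => ?_
  obtain ⟨m, rfl⟩ := Nat.exists_eq_add_of_le (Nat.lt_succ_iff.1 (Finset.mem_range.1 hj))
  rw [Nat.add_sub_cancel_left, show j + m + j = m + 2 * j by ring, pow_add _ m, pow_mul]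
  simp

lemma newtonCoeff_eq_zero {d N : ℕ} (h : d < N) : newtonCoeff d N = 0 := by
  -- `signedChoose d` is a polynomial function of degree at most `d`.
  let P : Polynomial ℝ := Polynomial.C ((-1) ^ d * (d.factorial : ℝ)⁻¹) *
    (descPochhammer ℝ d).comp (Polynomial.C (1 / 4) * (Polynomial.X - Polynomial.C 2))
  have hP : P.eval = signedChoose d := by
    funext x
    have h2 : (descPochhammer ℝ d).eval ((x - 2) / 4) =
        (descPochhammer ℤ d).smeval ((x - 2) / 4) := by
      rw [← descPochhammer_map (Int.castRingHom ℝ), Polynomial.eval_map,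
        Polynomial.eval₂_eq_sum, Polynomial.smeval_eq_sum]
      simp [Polynomial.sum_def, Polynomial.smul_pow]
    rw [signedChoose, Ring.choose_eq_smul, ← h2]
    simp only [P, Polynomial.eval_mul, Polynomial.eval_C, Polynomial.eval_comp, Polynomial.eval_sub,
      Polynomial.eval_X, smul_eq_mul]
    rw [show (1 / 4 * (x - 2)) = (x - 2) / 4 by ring, mul_assoc]
  have hdeg : P.natDegree < N := by
    refine lt_of_le_of_lt ?_ h
    refine (Polynomial.natDegree_C_mul_le _ _).trans ?_
    refine Polynomial.natDegree_comp_le.trans ?_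
    rw [descPochhammer_natDegree]
    have : (Polynomial.C (1 / 4 : ℝ) * (Polynomial.X - Polynomial.C 2)).natDegree ≤ 1 :=
      (Polynomial.natDegree_C_mul_le _ _).trans (Polynomial.natDegree_X_sub_C _).le
    nlinarith
  rw [← fwdDiff_iter_signedChoose, ← hP, Polynomial.fwdDiff_iter_eq_zero_of_degree_lt hdeg]
  rfl

/-- Newton's interpolation formula; the sum stops at `d`, the degree of `signedChoose d`, also
when `n > d`. -/
lemma signedChoose_eq_sum (d n : ℕ) :
    signedChoose d n = ∑ N ∈ Finset.range (d + 1), newtonCoeff d N * (n.choose N : ℝ) := by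
  have h := shift_eq_sum_fwdDiff_iter (1 : ℝ) (signedChoose d) n 0
  simp only [fwdDiff_iter_signedChoose, zero_add, nsmul_eq_mul, mul_one] at h
  rw [h]
  trans ∑ N ∈ Finset.range (max n d + 1), newtonCoeff d N * (n.choose N : ℝ)
  · refine (Finset.sum_subset (Finset.range_mono (by omega)) fun N _ hN => ?_).trans
      (Finset.sum_congr rfl fun N _ => mul_comm _ _)
    rw [Nat.choose_eq_zero_of_lt (by simpa using hN)]; simp
  · refine (Finset.sum_subset (Finset.range_mono (by omega)) fun N _ hN => ?_).symm
    rw [newtonCoeff_eq_zero (by simpa using hN), zero_mul]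

/-- Newton interpolation turns the diagonal operator into the differential operator
`∑_{N ≤ d} newtonCoeff d N / N! · x^N (d/dx)^N`. -/
lemma diag_signedChoose (d : ℕ) (F : ℂ⟦X⟧) :
    diag (fun n => (signedChoose d n : ℂ)) F = ∑ N ∈ Finset.range (d + 1),
      C ((newtonCoeff d N / N.factorial : ℝ) : ℂ) * (X ^ N * (d⁄dX ℂ)^[N] F) := by
  ext n
  rw [diag, coeff_mk, signedChoose_eq_sum, map_sum]
  push_cast
  rw [Finset.sum_mul]
  refine Finset.sum_congr rfl fun N _ => ?_
  rw [coeff_C_mul, coeff_X_pow_mul']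
  split_ifs with h
  · obtain ⟨m, rfl⟩ := Nat.exists_eq_add_of_le h
    rw [Nat.add_sub_cancel_left, coeff_iterate_derivative, add_comm N m]
    have h1 := Nat.descFactorial_eq_factorial_mul_choose (m + N) N
    have h2 : (N.factorial : ℂ) ≠ 0 := by exact_mod_cast N.factorial_ne_zero
    rw [Nat.add_descFactorial_eq_ascFactorial] at h1
    have h3 : (((m + 1).ascFactorial N : ℕ) : ℂ) = N.factorial * (m + N).choose N := by
      exact_mod_cast h1
    rw [h3]
    field_simp
  · rw [Nat.choose_eq_zero_of_lt (by omega)]; simp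

/-! ### Quotients of derivatives -/

/-- The quotient `x^N F^{(N)} / F` for `F = sin (π x) sinh (π x)`. It is a polynomial in
`x`, `π x cot (π x)` and `π x coth (π x)`, with period four up to a factor because
`F'''' = -4π⁴ F`. -/
noncomputable def derivRatio : ℕ → ℂ⟦X⟧
  | 0 => 1
  | 1 => cothSeries + cotSeries
  | 2 => 2 * (cothSeries * cotSeries)
  | 3 => C (2 * (Real.pi : ℂ) ^ 2) * X ^ 2 * (cotSeries - cothSeries)
  | n + 4 => C (-4 * (Real.pi : ℂ) ^ 4) * X ^ 4 * derivRatio n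

lemma derivRatio_four_mul_add (k i : ℕ) :
    derivRatio (4 * k + i) = C ((-4 * (Real.pi : ℂ) ^ 4) ^ k) * X ^ (4 * k) * derivRatio i := by
  induction k with
  | zero => simp
  | succ k ih =>
    rw [show 4 * (k + 1) + i = (4 * k + i) + 4 by ring, derivRatio, ih, pow_succ _ k,
      map_mul C (_ ^ k)]
    ring

lemma X_pow_mul_iterate_derivative (N : ℕ) :
    X ^ N * (d⁄dX ℂ)^[N] sinSinhSeries = sinSinhSeries * derivRatio N := by
  have hI : (C Complex.I : ℂ⟦X⟧) * C Complex.I = -1 := by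
    rw [← map_mul, Complex.I_mul_I, map_neg, map_one]
  have h1 := cothSeries_mul_sinhSeries
  have h2 := cotSeries_mul_sinhSeries
  have d1 : d⁄dX ℂ sinSinhSeries = C (Real.pi : ℂ) * (coshSeries Real.pi *
      sinhSeries (Real.pi * Complex.I) + C Complex.I * (sinhSeries Real.pi *
      coshSeries (Real.pi * Complex.I))) := by
    simp only [sinSinhSeries, Derivation.leibniz, smul_eq_mul, derivative_sinhSeries, map_mul]
    ring
  have d2 : d⁄dX ℂ (d⁄dX ℂ sinSinhSeries) = 2 * C Complex.I * C (Real.pi : ℂ) ^ 2 *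
      (coshSeries Real.pi * coshSeries (Real.pi * Complex.I)) := by
    rw [d1]
    simp only [map_add, Derivation.leibniz, smul_eq_mul, derivative_sinhSeries,
      derivative_coshSeries, map_mul, derivative_C]
    linear_combination (C (Real.pi : ℂ) ^ 2 * sinhSeries Real.pi *
      sinhSeries (Real.pi * Complex.I)) * hI
  have d3 : d⁄dX ℂ (d⁄dX ℂ (d⁄dX ℂ sinSinhSeries)) = 2 * C (Real.pi : ℂ) ^ 3 *
      (C Complex.I * (sinhSeries Real.pi * coshSeries (Real.pi * Complex.I)) -
        coshSeries Real.pi * sinhSeries (Real.pi * Complex.I)) := by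
    rw [d2, show (2 : ℂ⟦X⟧) = C 2 from rfl, ← map_pow]
    simp only [Derivation.leibniz, smul_eq_mul, derivative_coshSeries, map_mul,
      derivative_C]
    rw [map_pow]
    linear_combination (C 2 * C (Real.pi : ℂ) ^ 3 * coshSeries Real.pi *
      sinhSeries (Real.pi * Complex.I)) * hI
  have d4 : d⁄dX ℂ (d⁄dX ℂ (d⁄dX ℂ (d⁄dX ℂ sinSinhSeries))) =
      C (-4 * (Real.pi : ℂ) ^ 4) * sinSinhSeries := by
    rw [d3, show (2 : ℂ⟦X⟧) = C 2 from rfl, ← map_pow]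
    simp only [map_sub, Derivation.leibniz, smul_eq_mul, derivative_sinhSeries,
      derivative_coshSeries, map_mul, derivative_C, sinSinhSeries]
    rw [map_pow, map_pow, show (C (-4 : ℂ)) = -(C 2 * C 2) by rw [← map_mul, ← map_neg]; norm_num,
      show (C (2 : ℂ)) = 2 from rfl]
    linear_combination (2 * C (Real.pi : ℂ) ^ 4 * sinhSeries Real.pi *
      sinhSeries (Real.pi * Complex.I)) * hI
  rw [map_mul] at h2
  induction N using Nat.strong_induction_on with
  | _ N ih =>
    match N with
    | 0 => simp [derivRatio]
    | 1 =>
      rw [Function.iterate_one, d1, derivRatio, sinSinhSeries]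
      linear_combination (-sinhSeries (Real.pi * Complex.I)) * h1 - sinhSeries Real.pi * h2
    | 2 =>
      simp only [Function.iterate_succ_apply, Function.iterate_zero_apply]
      rw [d2, derivRatio, sinSinhSeries]
      linear_combination (-2 * (cotSeries * sinhSeries (Real.pi * Complex.I))) * h1
        - 2 * (C (Real.pi : ℂ) * X * coshSeries Real.pi) * h2
    | 3 =>
      simp only [Function.iterate_succ_apply, Function.iterate_zero_apply]
      rw [d3, derivRatio, sinSinhSeries, map_mul, map_pow, show (C (2 : ℂ)) = 2 from rfl]
      linear_combination (2 * C (Real.pi : ℂ) ^ 2 * X ^ 2) *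
        (sinhSeries (Real.pi * Complex.I) * h1 - sinhSeries Real.pi * h2)
    | N + 4 =>
      rw [Function.iterate_add_apply]
      have h4 : (d⁄dX ℂ)^[4] sinSinhSeries = C (-4 * (Real.pi : ℂ) ^ 4) * sinSinhSeries := d4
      rw [h4, ← smul_eq_C_mul]
      have hs : ∀ (c : ℂ) (m : ℕ) (G : ℂ⟦X⟧), (d⁄dX ℂ)^[m] (c • G) = c • (d⁄dX ℂ)^[m] G := by
        intro c m G
        induction m with
        | zero => rfl
        | succ m ih => simp only [Function.iterate_succ_apply', ih, Derivation.map_smul]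
      rw [hs, smul_eq_C_mul, derivRatio]
      linear_combination (C (-4 * (Real.pi : ℂ) ^ 4) * X ^ 4) * ih N (by omega)

lemma sinSinhSeries_ne_zero : sinSinhSeries ≠ 0 := by
  have h : ∀ a : ℂ, a ≠ 0 → sinhSeries a ≠ 0 := by
    intro a ha h
    have h1 := congrArg (coeff 1) h
    rw [sinhSeries, map_sub, coeff_expSeries, coeff_expSeries] at h1
    apply ha
    simp at h1
    exact h1
  exact mul_ne_zero (h _ (by exact_mod_cast Real.pi_ne_zero)) (h _ piI_ne)

/-- Cancelling `sinSinhSeries` in `diag_sinSinhSeries` expresses the generating series of `Q(4n, d)`. -/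
lemma zetaSeries_four_eq (d : ℕ) :
    zetaSeries 4 d = ∑ N ∈ Finset.range (d + 1),
      C ((newtonCoeff d N / N.factorial : ℝ) : ℂ) * derivRatio N := by
  apply mul_left_cancel₀ sinSinhSeries_ne_zero
  rw [← diag_sinSinhSeries, diag_signedChoose, Finset.mul_sum]
  refine Finset.sum_congr rfl fun N _ => ?_
  rw [X_pow_mul_iterate_derivative]; ring

/-! ### Comparison of coefficients -/

lemma coeff_zetaSeries_four (n d : ℕ) : coeff (4 * n) (zetaSeries 4 d) = (restrictedSum n d : ℂ) := by
  rw [zetaSeries, coeff_mk, restrictedSum]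
  congr 1
  symm
  refine Finset.sum_bij (fun j _ i => 4 * j i) ?_ ?_ ?_ ?_
  · intro j hj
    simp only [Finset.mem_filter, Finset.mem_finAntidiagonal] at hj ⊢
    exact ⟨by rw [← Finset.mul_sum, hj.1], fun i => ⟨dvd_mul_right _ _, by have := hj.2 i; omega⟩⟩
  · intro a _ b _ h
    funext i
    have := congrFun h i
    omega
  · intro j hj
    simp only [Finset.mem_filter, Finset.mem_finAntidiagonal] at hj
    have h4 : ∀ i, 4 * (j i / 4) = j i := fun i => Nat.mul_div_cancel' (hj.2 i).1
    refine ⟨fun i => j i / 4, ?_, funext h4⟩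
    simp only [Finset.mem_filter, Finset.mem_finAntidiagonal]
    refine ⟨?_, fun i => ?_⟩
    · have : 4 * ∑ i, j i / 4 = 4 * n := by rw [Finset.mul_sum, Finset.sum_congr rfl fun i _ => h4 i, hj.1]
      omega
    · have := h4 i; have := (hj.2 i).2; omega
  · intro _ _; rfl

lemma restrictedSum_eq_sum (n d : ℕ) :
    restrictedSum n d = ∑ N ∈ Finset.range (d + 1),
      newtonCoeff d N / N.factorial * (coeff (4 * n) (derivRatio N)).re := by
  have h := coeff_zetaSeries_four n d
  rw [zetaSeries_four_eq, map_sum] at h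
  have h' := congrArg Complex.re h
  rw [Complex.ofReal_re, Complex.re_sum] at h'
  rw [← h']
  exact Finset.sum_congr rfl fun N _ => by rw [coeff_C_mul, Complex.re_ofReal_mul]

lemma coeff_derivRatio_four_mul_add {k i n : ℕ} (h : k ≤ n) :
    (coeff (4 * n) (derivRatio (4 * k + i))).re =
      (-4 * Real.pi ^ 4) ^ k * (coeff (4 * n - 4 * k) (derivRatio i)).re := by
  rw [derivRatio_four_mul_add, mul_assoc, coeff_C_mul, coeff_X_pow_mul', if_pos (by omega),
    ← Complex.re_ofReal_mul]
  push_cast; rfl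

lemma coeff_derivRatio_four_mul {k n : ℕ} (h : k < n) :
    (coeff (4 * n) (derivRatio (4 * k))).re = 0 := by
  have := coeff_derivRatio_four_mul_add (i := 0) h.le
  rw [add_zero] at this
  rw [this, derivRatio, coeff_one, if_neg (by omega)]; simp

lemma coeff_cothSeries_even {k : ℕ} (hk : k ≠ 0) :
    coeff (2 * k) cothSeries = -2 * (-1) ^ k * (multipleZeta ![2 * k] : ℂ) := by
  rw [coeff_cothSeries, if_neg (by omega), if_pos (even_two_mul k),
    Nat.mul_div_cancel_left _ two_pos]

lemma coeff_cotSeries_even {k : ℕ} (hk : k ≠ 0) :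
    coeff (2 * k) cotSeries = -2 * (multipleZeta ![2 * k] : ℂ) := by
  rw [coeff_cotSeries, if_neg (by omega), if_pos (even_two_mul k)]

lemma coeff_derivRatio_odd {k n : ℕ} (h : 2 * k < 4 * n) :
    (coeff (4 * n) (derivRatio (2 * k + 1))).re =
      -4 * 2 ^ k * (-1) ^ (k / 2) * Real.pi ^ (2 * k) * multipleZeta ![4 * n - 2 * k] := by
  rcases Nat.even_or_odd' k with ⟨m, rfl | rfl⟩
  · rw [show 2 * (2 * m) + 1 = 4 * m + 1 by ring, coeff_derivRatio_four_mul_add (by omega),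
      derivRatio, map_add, show 4 * n - 4 * m = 2 * (2 * n - 2 * m) by omega,
      coeff_cothSeries_even (by omega), coeff_cotSeries_even (by omega),
      Even.neg_one_pow (by rw [Nat.even_iff]; omega), Nat.mul_div_cancel_left _ two_pos,
      show 4 * n - 2 * (2 * m) = 2 * (2 * n - 2 * m) by omega, mul_one,
      ← Complex.ofReal_ofNat, ← Complex.ofReal_neg,
      ← Complex.ofReal_mul, ← Complex.ofReal_add, Complex.ofReal_re, mul_pow, ← pow_mul, pow_mul 2,
      show (-4 : ℝ) = (-1) * 2 ^ 2 by norm_num, mul_pow]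
    norm_num
    ring
  · rw [show 2 * (2 * m + 1) + 1 = 4 * m + 3 by ring, coeff_derivRatio_four_mul_add (by omega),
      derivRatio, mul_assoc, coeff_C_mul, coeff_X_pow_mul', if_pos (by omega),
      map_sub, show 4 * n - 4 * m - 2 = 2 * (2 * n - 2 * m - 1) by omega,
      coeff_cothSeries_even (by omega), coeff_cotSeries_even (by omega),
      Odd.neg_one_pow (by rw [Nat.odd_iff]; omega), show (2 * m + 1) / 2 = m by omega,
      show 4 * n - 2 * (2 * m + 1) = 2 * (2 * n - 2 * m - 1) by omega]
    have : (2 * (Real.pi : ℂ) ^ 2 * (-2 * (multipleZeta ![2 * (2 * n - 2 * m - 1)] : ℂ) -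
        -2 * -1 * (multipleZeta ![2 * (2 * n - 2 * m - 1)] : ℂ))) =
        ((-8 * Real.pi ^ 2 * multipleZeta ![2 * (2 * n - 2 * m - 1)] : ℝ) : ℂ) := by
      push_cast; ring
    rw [this, Complex.ofReal_re, mul_pow, ← pow_mul, pow_add 2, pow_mul 2,
      show (-4 : ℝ) = (-1) * 2 ^ 2 by norm_num, mul_pow]
    ring

lemma newtonCoeff_two : newtonCoeff 2 1 = - 7 / 32 ∧ newtonCoeff 2 2 = 1 / 16 := by
  have h : ∀ x, signedChoose 2 x = ((x - 2) / 4) * ((x - 2) / 4 - 1) / 2 := by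
    intro x
    rw [signedChoose, Ring.choose_eq_smul, descPochhammer_succ_right]
    simp [Polynomial.smeval_mul, Polynomial.smeval_sub, Polynomial.smeval_X]
    ring
  simp only [newtonCoeff, h, Finset.sum_range_succ, Finset.sum_range_zero]
  norm_num [Nat.choose]

/-- The coefficients of `2 π² x² cot (π x) coth (π x)`, read off from the case `d = 2` of
`restrictedSum_eq_sum`. -/
lemma coeff_derivRatio_two {m : ℕ} (hm : 0 < m) :
    (coeff (4 * m) (derivRatio 2)).re =
      32 * (restrictedSum m 2 - 7 / 8 * multipleZeta ![4 * m]) := by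
  have h := restrictedSum_eq_sum m 2
  have h0 := coeff_derivRatio_four_mul hm
  have h1 := coeff_derivRatio_odd (show 2 * 0 < 4 * m by omega)
  simp only [Finset.sum_range_succ, Finset.sum_range_zero] at h
  rw [mul_zero] at h0
  simp only [mul_zero, zero_add] at h1
  rw [h0, h1, newtonCoeff_two.1, newtonCoeff_two.2] at h
  norm_num at h
  rw [h]; ring

/-- A sum over `N ≤ d` whose terms with `4 ∣ N` vanish, split into odd `N` and `N ≡ 2 mod 4`. -/
lemma sum_range_split {d : ℕ} (hd : 2 ≤ d) (a : ℕ → ℝ) (ha : ∀ k, 4 * k ≤ d → a (4 * k) = 0) :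
    ∑ N ∈ Finset.range (d + 1), a N =
      ∑ k ∈ Finset.range ((d - 1) / 2 + 1), a (2 * k + 1) +
        ∑ k ∈ Finset.range ((d - 2) / 4 + 1), a (4 * k + 2) := by
  classical
  rw [← Finset.sum_image (f := a) (g := fun k => 2 * k + 1) (by intro x _ y _ h; simp at h; exact h),
    ← Finset.sum_image (f := a) (g := fun k => 4 * k + 2) (by intro x _ y _ h; simp at h; exact h),
    ← Finset.sum_union]
  · symm
    refine Finset.sum_subset ?_ ?_
    · intro N hN
      simp only [Finset.mem_union, Finset.mem_image, Finset.mem_range] at hN ⊢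
      omega
    · intro N hN hN'
      simp only [Finset.mem_union, Finset.mem_image, Finset.mem_range, not_or, not_exists,
        not_and] at hN hN'
      have h1 := hN'.1 (N / 2)
      have h2 := hN'.2 (N / 4)
      rw [show N = 4 * (N / 4) by omega]
      exact ha _ (by omega)
  · rw [Finset.disjoint_left]
    intro N h1 h2
    simp only [Finset.mem_image, Finset.mem_range] at h1 h2
    omega

end RestrictedZetaSum

open RestrictedZetaSum

theorem theorem1 (n d : ℕ) (hd : 3 ≤ d) (hn : d ≤ n) :
    restrictedSum n d =
      (∑ k ∈ Finset.range ((d - 1) / 2 + 1), ∑ j ∈ Finset.range (2 * k + 2),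
        (2 : ℝ) ^ (k + 2) * (-1 : ℝ) ^ (k / 2 + j + d) / ((2 * k + 1).factorial : ℝ)
          * ((2 * k + 1).choose j : ℝ) * Ring.choose (((j : ℝ) - 2) / 4) d
          * multipleZeta ![4 * n - 2 * k] * Real.pi ^ (2 * k))
      + ∑ k ∈ Finset.range ((d - 2) / 4 + 1), ∑ j ∈ Finset.range (4 * k + 3),
        (2 : ℝ) ^ (2 * k + 5) * (-1 : ℝ) ^ (k + j + d) / ((4 * k + 2).factorial : ℝ)
          * ((4 * k + 2).choose j : ℝ) * Ring.choose (((j : ℝ) - 2) / 4) d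
          * (restrictedSum (n - k) 2 - 7 / 8 * multipleZeta ![4 * n - 4 * k])
          * Real.pi ^ (4 * k) := by
  rw [restrictedSum_eq_sum, sum_range_split (by omega) _ fun k hk => by
    rw [coeff_derivRatio_four_mul (by omega), mul_zero]]
  congr 1
  · refine Finset.sum_congr rfl fun k hk => ?_
    rw [Finset.mem_range] at hk
    rw [coeff_derivRatio_odd (by omega), newtonCoeff, Finset.sum_div, Finset.sum_mul]
    refine Finset.sum_congr rfl fun j _ => ?_
    rw [signedChoose, show 2 * k + 1 + j = 2 * k + (1 + j) by ring, pow_add (-1) (2 * k), pow_mul]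
    simp only [pow_add]
    norm_num
    ring
  · refine Finset.sum_congr rfl fun k hk => ?_
    rw [Finset.mem_range] at hk
    rw [coeff_derivRatio_four_mul_add (by omega), ← Nat.mul_sub, coeff_derivRatio_two (by omega),
      newtonCoeff, Finset.sum_div, Finset.sum_mul]
    refine Finset.sum_congr rfl fun j _ => ?_
    rw [signedChoose, show 4 * k + 2 + j = 2 * (2 * k + 1) + j by ring, pow_add (-1) (2 * _),
      pow_mul (-1) 2, mul_pow, ← pow_mul Real.pi, show (-4 : ℝ) = (-1) * 2 ^ 2 by norm_num, mul_pow,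
      ← pow_mul 2]
    simp only [pow_add]
    norm_num
    ring
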